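/- Let $d_A,d_B\ge 2$, $d=\min(d_A,d_B)$, and let $\rho$ be a state (a positive semidefinite matrix of trace $1$) on $\mathbb{C}^{d_A}\otimes\mathbb{C}^{d_B}$, with reduced states $\rho_A=\operatorname{Tr}_B\rho$ and $\rho_B=\operatorname{Tr}_A\rho$. Let $\mu\in\mathbb{R}^n$ and $\nu\in\mathbb{R}^m$ be arbitrary real column vectors with Euclidean norms $|\mu|,|\nu|$, where $n,m$ are positive integers. Let $\operatorname{Vec}$ be column-stacking vectorization. Write $\rho$ as a $d_A\times d_A$ block matrix with $d_B\times d_B$ blocks $\rho_{i,j}$, and let $\mathcal{R}(\rho)$ be the $d_A^2\times d_B^2$ realigned matrix with rows $\operatorname{Vec}(\rho_{1,1})^T,\dots,\operatorname{Vec}(\rho_{d_A,1})^T,\dots,\operatorname{Vec}(\rho_{1,d_A})^T,\dots,\operatorname{Vec}(\rho_{d_A,d_A})^T$. Put $$\mathcal{Q}_{\mu,\nu}(\rho)=\begin{pmatrix}\mu\nu^T & \mu\operatorname{Vec}(\rho_B)^T\\ \operatorname{Vec}(\rho_A)\nu^T & \mathcal{R}(\rho)\end{pmatrix},\qquad \|X\|_{\mathrm{Tr}}=\operatorname{Tr}\sqrt{X^\dagger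 X}.$$ For a unit vector $|\varphi\rangle\in\mathbb{C}^{d_A}\otimes\mathbb{C}^{d_B}$ let $$\mathcal{N}(|\varphi\rangle)=\frac{\|(|\varphi\rangle\langle\varphi|)^{T_B}\|_{\mathrm{Tr}}-1}{d-1},$$ where $T_B$ denotes partial transposition on the second factor, and let the convex-roof extended negativity of $\rho$ be $$\mathcal{N}(\rho)=\inf_{\{p_i,|\varphi_i\rangle\}}\sum_i p_i\,\mathcal{N}(|\varphi_i\rangle),$$ over all finite decompositions $\rho=\sum_i p_i|\varphi_i\rangle\langle\varphi_i|$ with $p_i\ge 0$, $\sum_i p_i=1$ and unit vectors $|\varphi_i\rangle$. Then $$\mathcal{N}(\rho)\ \ge\ \frac{\|\mathcal{Q}_{\mu,\nu}(\rho)\|_{\mathrm{Tr}}-\sqrt{(|\mu|^2+1)(|\nu|^2+1)}}{d-1}.$$ -/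

import Mathlib

open scoped Matrix MatrixOrder ComplexOrder

namespace Realign

/-- The trace norm `Tr √(A† A)` of a rectangular complex matrix. The square root is the positive
semidefinite one; its trace is a non-negative real number, read off by the real part. -/
noncomputable def traceNorm {m n : Type*} [Fintype m] [Fintype n] [DecidableEq n]
    (A : Matrix m n ℂ) : ℝ :=
  (Matrix.trace (CFC.sqrt (Aᴴ * A))).re

section Bipartite

variable {dA dB : ℕ}

/-- Operators on `ℂ^dA ⊗ ℂ^dB`, in the product basis; the row of `|i_A k_B⟩` is `(i, k)`. -/
abbrev BipartiteMatrix (dA dB : ℕ) : Type :=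
  Matrix (Fin dA × Fin dB) (Fin dA × Fin dB) ℂ

/-- Vectors of `ℂ^dA ⊗ ℂ^dB`, in the product basis. -/
abbrev BipartiteVector (dA dB : ℕ) : Type :=
  EuclideanSpace ℂ (Fin dA × Fin dB)

/-- A state (density matrix): positive semidefinite of trace one. -/
def IsState (ρ : BipartiteMatrix dA dB) : Prop :=
  ρ.PosSemidef ∧ ρ.trace = 1

/-- The `(i, j)` sub-block, of size `dB × dB`. -/
def block (Z : BipartiteMatrix dA dB) (i j : Fin dA) : Matrix (Fin dB) (Fin dB) ℂ :=
  Matrix.of fun k l => Z (i, k) (j, l)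

/-- The reduced state of system `A`: the partial trace over `B`. -/
def reducedA (ρ : BipartiteMatrix dA dB) : Matrix (Fin dA) (Fin dA) ℂ :=
  Matrix.of fun i j => ∑ k, ρ (i, k) (j, k)

/-- The reduced state of system `B`: the partial trace over `A`. -/
def reducedB (ρ : BipartiteMatrix dA dB) : Matrix (Fin dB) (Fin dB) ℂ :=
  Matrix.of fun k l => ∑ i, ρ (i, k) (i, l)

/-- The transpose on the second factor. -/
def partialTransposeB (ρ : BipartiteMatrix dA dB) : BipartiteMatrix dA dB :=
  Matrix.of fun x y => ρ (x.1, y.2) (y.1, x.2)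

/-- The realigned matrix. Its rows are the transposed column-stacking vectorizations of the
sub-blocks. Like an entry of `Matrix.vec`, a row is labelled `(j, i)` (column first), so the rows
come in the order `Z₁₁, Z₂₁, …, Z₁₂, Z₂₂, …`. -/
def realign (Z : BipartiteMatrix dA dB) : Matrix (Fin dA × Fin dA) (Fin dB × Fin dB) ℂ :=
  Matrix.of fun p => (block Z p.2 p.1).vec

/-- A real vector regarded as a complex one. -/
noncomputable def complexify {n : ℕ} (μ : EuclideanSpace ℝ (Fin n)) : Fin n → ℂ :=
  fun i => ((μ i : ℝ) : ℂ)

/-- The block matrix with rows `(μ νᵀ, μ Vec(ρ_B)ᵀ)` and `(Vec(ρ_A) νᵀ, R(ρ))`. -/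
noncomputable def Q {n m : ℕ} (μ : EuclideanSpace ℝ (Fin n)) (ν : EuclideanSpace ℝ (Fin m))
    (ρ : BipartiteMatrix dA dB) :
    Matrix (Fin n ⊕ Fin dA × Fin dA) (Fin m ⊕ Fin dB × Fin dB) ℂ :=
  Matrix.fromBlocks
    (Matrix.vecMulVec (complexify μ) (complexify ν))
    (Matrix.vecMulVec (complexify μ) (reducedB ρ).vec)
    (Matrix.vecMulVec (reducedA ρ).vec (complexify ν))
    (realign ρ)

/-- The projector `|φ⟩⟨φ|`. -/
noncomputable def projector (φ : BipartiteVector dA dB) : BipartiteMatrix dA dB :=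
  Matrix.vecMulVec (fun x => φ x) (fun x => star (φ x))

/-- The negativity `(‖(|φ⟩⟨φ|)^{T_B}‖_Tr - 1) / (d - 1)`, `d = min dA dB`, of a pure state. -/
noncomputable def pureNegativity (φ : BipartiteVector dA dB) : ℝ :=
  (traceNorm (partialTransposeB (projector φ)) - 1) / (((min dA dB : ℕ) : ℝ) - 1)

/-- `{p i, φ i}` is a decomposition of `ρ` as a convex combination of pure states. -/
def IsPureDecomposition {k : ℕ} (p : Fin k → ℝ) (φ : Fin k → BipartiteVector dA dB)
    (ρ : BipartiteMatrix dA dB) : Prop :=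
  (∀ i, 0 ≤ p i) ∧ ∑ i, p i = 1 ∧ (∀ i, ‖φ i‖ = 1) ∧ ρ = ∑ i, (p i : ℂ) • projector (φ i)

/-- The convex-roof extended negativity: the infimum of the average negativity over all
finite pure-state decompositions. For a state it is an infimum over a nonempty set (spectral
decomposition), so wherever the minimum is attained the two agree. -/
noncomputable def cren (ρ : BipartiteMatrix dA dB) : ℝ :=
  sInf {x : ℝ | ∃ (k : ℕ) (p : Fin k → ℝ) (φ : Fin k → BipartiteVector dA dB),
    IsPureDecomposition p φ ρ ∧ x = ∑ i, p i * pureNegativity (φ i)}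

end Bipartite

end Realign

/-!
Multiplying the corner block of `Q` by `tr Z` makes the block matrix linear in `Z` and sends a
product operator `X ⊗ Y` to the rank-one matrix `(tr(X) μ, Vec X) (tr(Y) ν, Vec Y)ᵀ`. If
`φ = ∑ s_j u_j ⊗ w_j` is a Schmidt decomposition of a unit vector, then
`|φ⟩⟨φ| = ∑ s_j s_l |u_j⟩⟨u_l| ⊗ |w_j⟩⟨w_l|`, and the rank-one matrix of the term `(j, l)` has
trace norm `√((|μ|² + 1) (|ν|² + 1))` if `j = l` and `1` otherwise. By the triangle inequality and
`∑ s_j² = 1`, the trace norm of `Q` at `|φ⟩⟨φ|` is at most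
`(∑ s_j)² - 1 + √((|μ|² + 1) (|ν|² + 1))`. The partial transpose of `|φ⟩⟨φ|` is, up to a relabelling
of its columns, `C ⊗ Cᴴ` for the coefficient matrix `C` of `φ`, so `(∑ s_j)²` is its trace norm.
Convexity of the trace norm passes from pure states to mixtures.
-/

namespace Realign

open Matrix
open scoped Kronecker

section TraceNorm

variable {m n m' n' : Type*} [Fintype m] [Fintype n] [Fintype m'] [Fintype n']

lemma exists_posSemidef_mul_self_eq (A : Matrix m n ℂ) :
    ∃ P : Matrix n n ℂ, P.PosSemidef ∧ P * P = Aᴴ * A := by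
  classical
  exact ⟨CFC.sqrt (Aᴴ * A), nonneg_iff_posSemidef.1 (CFC.sqrt_nonneg _),
    CFC.sqrt_mul_sqrt_self _ (posSemidef_conjTranspose_mul_self A).nonneg⟩

variable [DecidableEq n] [DecidableEq n']

lemma ofReal_traceNorm_eq_trace {A : Matrix m n ℂ} {P : Matrix n n ℂ} (hP : P.PosSemidef)
    (hPP : P * P = Aᴴ * A) : (traceNorm A : ℂ) = P.trace := by
  rw [traceNorm, CFC.sqrt_unique hPP hP.nonneg]
  exact Complex.ext rfl (Complex.nonneg_iff.1 hP.trace_nonneg).2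

lemma traceNorm_smul (c : ℂ) (A : Matrix m n ℂ) : traceNorm (c • A) = ‖c‖ * traceNorm A := by
  obtain ⟨P, hP, hPP⟩ := exists_posSemidef_mul_self_eq A
  have hcP : ((‖c‖ : ℂ) • P).PosSemidef := hP.smul (by exact_mod_cast norm_nonneg c)
  have hsq : ((‖c‖ : ℂ) • P) * ((‖c‖ : ℂ) • P) = (c • A)ᴴ * (c • A) := by
    rw [smul_mul_smul_comm, hPP, conjTranspose_smul, Matrix.smul_mul, Matrix.mul_smul, smul_smul,
      ← pow_two, ← Complex.conj_mul', starRingEnd_apply]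
  apply Complex.ofReal_injective
  rw [ofReal_traceNorm_eq_trace hcP hsq, trace_smul, ← ofReal_traceNorm_eq_trace hP hPP,
    smul_eq_mul, Complex.ofReal_mul]

lemma traceNorm_submatrix_equiv (A : Matrix m n ℂ) (e : m' ≃ m) (f : n' ≃ n) :
    traceNorm (A.submatrix e f) = traceNorm A := by
  obtain ⟨P, hP, hPP⟩ := exists_posSemidef_mul_self_eq A
  have hsq : P.submatrix f f * P.submatrix f f = (A.submatrix e f)ᴴ * A.submatrix e f := by
    rw [submatrix_mul_equiv, hPP, conjTranspose_submatrix, submatrix_mul_equiv]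
  apply Complex.ofReal_injective
  rw [ofReal_traceNorm_eq_trace (hP.submatrix f) hsq, ofReal_traceNorm_eq_trace hP hPP]
  exact f.sum_comp fun i => P i i

lemma traceNorm_kronecker (A : Matrix m n ℂ) (B : Matrix m' n' ℂ) :
    traceNorm (A ⊗ₖ B) = traceNorm A * traceNorm B := by
  obtain ⟨P, hP, hPP⟩ := exists_posSemidef_mul_self_eq A
  obtain ⟨R, hR, hRR⟩ := exists_posSemidef_mul_self_eq B
  have hsq : (P ⊗ₖ R) * (P ⊗ₖ R) = (A ⊗ₖ B)ᴴ * (A ⊗ₖ B) := by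
    rw [← mul_kronecker_mul, hPP, hRR, conjTranspose_kronecker, ← mul_kronecker_mul]
  apply Complex.ofReal_injective
  rw [ofReal_traceNorm_eq_trace (hP.kronecker hR) hsq, trace_kronecker,
    ← ofReal_traceNorm_eq_trace hP hPP, ← ofReal_traceNorm_eq_trace hR hRR, Complex.ofReal_mul]

end TraceNorm

lemma sum_norm_sq_of_conjTranspose_mul_self_eq_diagonal {m n : Type*} [Fintype m] [DecidableEq n]
    {B : Matrix m n ℂ} {d : n → ℝ} (hB : Bᴴ * B = diagonal fun j => (d j : ℂ)) (j : n) :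
    ∑ a, ‖B a j‖ ^ 2 = d j := by
  have h : ∑ a, star (B a j) * B a j = d j := by
    simpa [Matrix.mul_apply] using congrFun₂ hB j j
  simp only [Complex.star_def, Complex.conj_mul'] at h
  exact_mod_cast h

lemma submatrix_mul_one_submatrix_of_apply_eq_zero {m n ι : Type*} [Fintype ι] [DecidableEq n]
    {B : Matrix m n ℂ} {f : ι → n} (hf : Function.Injective f)
    (hzero : ∀ a, ∀ j ∉ Set.range f, B a j = 0) :
    B.submatrix id f * (1 : Matrix n n ℂ).submatrix f id = B := by
  classical
  ext a j
  simp only [Matrix.mul_apply, submatrix_apply, id_eq, one_apply, mul_ite, mul_one, mul_zero]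
  by_cases hj : j ∈ Set.range f
  · obtain ⟨k, rfl⟩ := hj
    simp [hf.eq_iff]
  · rw [hzero a j hj, Finset.sum_eq_zero fun k _ => if_neg fun h => hj ⟨k, h⟩]

section SVD

variable {m n ι : Type*} [Fintype m] [Fintype n] [Fintype ι] [DecidableEq ι]

/-- A compact singular value decomposition `A = U diag(s) Vᴴ`, with the singular vectors as the
columns of `U` and `V`. The index type `ι` need only account for the nonzero singular values. -/
structure IsSVD (A : Matrix m n ℂ) (U : Matrix m ι ℂ) (s : ι → ℝ) (V : Matrix n ι ℂ) : Prop where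
  nonneg : ∀ j, 0 ≤ s j
  left_isometry : Uᴴ * U = 1
  right_isometry : Vᴴ * V = 1
  eq_mul : A = U * diagonal (fun j => (s j : ℂ)) * Vᴴ

namespace IsSVD

variable {A : Matrix m n ℂ} {U : Matrix m ι ℂ} {s : ι → ℝ} {V : Matrix n ι ℂ}

lemma apply_eq_sum (h : IsSVD A U s V) (a : m) (b : n) :
    A a b = ∑ j, U a j * s j * star (V b j) := by
  simp only [h.eq_mul, Matrix.mul_apply (N := Vᴴ), mul_diagonal, conjTranspose_apply]

lemma conjTranspose (h : IsSVD A U s V) : IsSVD Aᴴ V s U where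
  nonneg := h.nonneg
  left_isometry := h.right_isometry
  right_isometry := h.left_isometry
  eq_mul := by
    have hD : star (fun j => (s j : ℂ)) = fun j => (s j : ℂ) :=
      funext fun j => Complex.conj_ofReal _
    rw [h.eq_mul, conjTranspose_mul, conjTranspose_mul, conjTranspose_conjTranspose,
      diagonal_conjTranspose, hD, Matrix.mul_assoc]

lemma mul_conjTranspose (h : IsSVD A U s V) {l : Type*} [Fintype l] {E : Matrix l n ℂ}
    [DecidableEq n] (hE : Eᴴ * E = 1) : IsSVD (A * Eᴴ) U s (E * V) where
  nonneg := h.nonneg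
  left_isometry := h.left_isometry
  right_isometry := by
    rw [conjTranspose_mul, Matrix.mul_assoc, ← Matrix.mul_assoc Eᴴ, hE, Matrix.one_mul,
      h.right_isometry]
  eq_mul := by rw [conjTranspose_mul, ← Matrix.mul_assoc, ← h.eq_mul]

lemma conjTranspose_mul_self (h : IsSVD A U s V) :
    Aᴴ * A = V * diagonal (fun j => (s j : ℂ) ^ 2) * Vᴴ := by
  calc Aᴴ * A
      = V * (diagonal (fun j => (s j : ℂ)) * (Uᴴ * U) * diagonal fun j => (s j : ℂ)) * Vᴴ := by
        nth_rw 1 [h.conjTranspose.eq_mul, h.eq_mul]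
        simp only [Matrix.mul_assoc]
    _ = V * diagonal (fun j => (s j : ℂ) ^ 2) * Vᴴ := by
        simp only [h.left_isometry, Matrix.mul_one, diagonal_mul_diagonal, pow_two]

lemma trace_conjTranspose_mul_self (h : IsSVD A U s V) :
    (Aᴴ * A).trace = ∑ j, (s j : ℂ) ^ 2 := by
  rw [h.conjTranspose_mul_self, trace_mul_comm, ← Matrix.mul_assoc, h.right_isometry,
    Matrix.one_mul, trace_diagonal]

lemma traceNorm_eq_sum [DecidableEq n] (h : IsSVD A U s V) : traceNorm A = ∑ j, s j := by
  set D : Matrix ι ι ℂ := diagonal fun j => (s j : ℂ)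
  have hP : (V * D * Vᴴ).PosSemidef :=
    (PosSemidef.diagonal fun j => Complex.zero_le_real.2 (h.nonneg j)).mul_mul_conjTranspose_same V
  have hsq : V * D * Vᴴ * (V * D * Vᴴ) = Aᴴ * A := by
    calc V * D * Vᴴ * (V * D * Vᴴ)
        = V * (D * (Vᴴ * V) * D) * Vᴴ := by simp only [Matrix.mul_assoc]
      _ = Aᴴ * A := by
        rw [h.right_isometry, Matrix.mul_one, diagonal_mul_diagonal, h.conjTranspose_mul_self]
        simp only [pow_two]
  apply Complex.ofReal_injective
  rw [ofReal_traceNorm_eq_trace hP hsq, trace_mul_comm, ← Matrix.mul_assoc, h.right_isometry,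
    Matrix.one_mul, trace_diagonal, Complex.ofReal_sum]

end IsSVD

lemma isSVD_of_conjTranspose_mul_self_eq_diagonal [DecidableEq n] {B : Matrix m n ℂ} {d : n → ℝ}
    (hB : Bᴴ * B = diagonal fun j => (d j : ℂ)) {f : ι → n} (hf : Function.Injective f)
    (hpos : ∀ k, 0 < d (f k)) (hzero : ∀ j ∉ Set.range f, d j = 0) :
    IsSVD B (B.submatrix id f * diagonal fun k => (√(d (f k)) : ℂ)⁻¹) (fun k => √(d (f k)))
      ((1 : Matrix n n ℂ).submatrix id f) where
  nonneg k := Real.sqrt_nonneg _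
  left_isometry := by
    have hstar : star (fun k => (√(d (f k)) : ℂ)⁻¹) = fun k => (√(d (f k)) : ℂ)⁻¹ := by
      ext k
      simp
    have hinv : ∀ k, (√(d (f k)) : ℂ)⁻¹ * d (f k) * (√(d (f k)) : ℂ)⁻¹ = 1 := fun k => by
      have hne := (Real.sqrt_pos.2 (hpos k)).ne'
      rw [← Complex.ofReal_inv, ← Complex.ofReal_mul, ← Complex.ofReal_mul, ← Complex.ofReal_one]
      congr 1
      field_simp
      exact (Real.sq_sqrt (hpos k).le).symm
    calc (B.submatrix id f * diagonal fun k => (√(d (f k)) : ℂ)⁻¹)ᴴ *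
          (B.submatrix id f * diagonal fun k => (√(d (f k)) : ℂ)⁻¹)
        = (diagonal fun k => (√(d (f k)) : ℂ)⁻¹) * (Bᴴ * B).submatrix f f *
            diagonal fun k => (√(d (f k)) : ℂ)⁻¹ := by
          rw [conjTranspose_mul, diagonal_conjTranspose, hstar, conjTranspose_submatrix,
            submatrix_mul _ _ f id f Function.bijective_id]
          simp only [Matrix.mul_assoc]
      _ = 1 := by
          rw [hB, submatrix_diagonal _ _ hf, diagonal_mul_diagonal, diagonal_mul_diagonal,
            ← diagonal_one]
          exact congrArg diagonal (funext hinv)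
  right_isometry := by
    rw [conjTranspose_submatrix, ← submatrix_mul _ _ f id f Function.bijective_id,
      conjTranspose_one, Matrix.one_mul, submatrix_one _ hf]
  eq_mul := by
    have hinv : ∀ k, (√(d (f k)) : ℂ)⁻¹ * √(d (f k)) = 1 := fun k =>
      inv_mul_cancel₀ (by exact_mod_cast (Real.sqrt_pos.2 (hpos k)).ne')
    have hcol : ∀ a, ∀ j ∉ Set.range f, B a j = 0 := fun a j hj => by
      have h := sum_norm_sq_of_conjTranspose_mul_self_eq_diagonal hB j
      rw [hzero j hj, Finset.sum_eq_zero_iff_of_nonneg fun _ _ => sq_nonneg _] at h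
      simpa using h a (Finset.mem_univ a)
    rw [Matrix.mul_assoc (B.submatrix id f), diagonal_mul_diagonal, funext hinv, diagonal_one,
      Matrix.mul_one, conjTranspose_submatrix, conjTranspose_one,
      submatrix_mul_one_submatrix_of_apply_eq_zero hf hcol]

-- `A` maps an orthonormal eigenbasis of `Aᴴ * A` to orthogonal vectors; normalizing those that do
-- not vanish gives `U`.
theorem exists_isSVD (A : Matrix m n ℂ) :
    ∃ (r : ℕ) (U : Matrix m (Fin r) ℂ) (s : Fin r → ℝ) (V : Matrix n (Fin r) ℂ),
      IsSVD A U s V := by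
  classical
  have hA := posSemidef_conjTranspose_mul_self A
  set d := hA.isHermitian.eigenvalues
  set E : Matrix n n ℂ := hA.isHermitian.eigenvectorUnitary.1
  have hEE : Eᴴ * E = 1 := Unitary.coe_star_mul_self hA.isHermitian.eigenvectorUnitary
  have hgram : (A * E)ᴴ * (A * E) = diagonal fun j => (d j : ℂ) := by
    have h := hA.isHermitian.conjStarAlgAut_star_eigenvectorUnitary
    rw [Unitary.conjStarAlgAut_star_apply] at h
    rw [conjTranspose_mul, Matrix.mul_assoc, ← Matrix.mul_assoc Aᴴ, ← Matrix.mul_assoc]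
    exact h
  let e := (Fintype.equivFin {j // d j ≠ 0}).symm
  have hSVD := (isSVD_of_conjTranspose_mul_self_eq_diagonal hgram (f := fun k => (e k : n))
    (Subtype.val_injective.comp e.injective)
    (fun k => (hA.eigenvalues_nonneg _).lt_of_ne' (e k).2)
    (fun j hj => of_not_not fun h => hj ⟨e.symm ⟨j, h⟩, by simp⟩)).mul_conjTranspose hEE
  rw [Matrix.mul_assoc, mul_eq_one_comm.1 hEE, Matrix.mul_one] at hSVD
  exact ⟨_, _, _, _, hSVD⟩

lemma traceNorm_nonneg [DecidableEq n] (A : Matrix m n ℂ) : 0 ≤ traceNorm A := by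
  obtain ⟨r, U, s, V, h⟩ := exists_isSVD A
  exact h.traceNorm_eq_sum.symm ▸ Finset.sum_nonneg fun j _ => h.nonneg j

theorem traceNorm_conjTranspose [DecidableEq m] [DecidableEq n] (A : Matrix m n ℂ) :
    traceNorm Aᴴ = traceNorm A := by
  obtain ⟨r, U, s, V, h⟩ := exists_isSVD A
  rw [h.conjTranspose.traceNorm_eq_sum, h.traceNorm_eq_sum]

end SVD

lemma norm_toLp_star {n : Type*} [Fintype n] (x : n → ℂ) :
    ‖WithLp.toLp 2 (star x)‖ = ‖WithLp.toLp 2 x‖ := by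
  simp only [EuclideanSpace.norm_eq, Pi.star_apply, norm_star]

section Duality

open scoped Matrix.Norms.L2Operator

variable {m n ι : Type*} [Fintype m] [Fintype n] [DecidableEq n]

lemma norm_apply_le_l2_opNorm (M : Matrix m n ℂ) (i : m) (j : n) : ‖M i j‖ ≤ ‖M‖ := by
  have h := M.l2_opNorm_mulVec (EuclideanSpace.single j 1)
  rw [PiLp.norm_single, norm_one, mul_one] at h
  simpa using (PiLp.norm_apply_le _ i).trans h

lemma l2_opNorm_le_one_of_conjTranspose_mul_self_eq_one {U : Matrix m n ℂ} (hU : Uᴴ * U = 1) :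
    ‖U‖ ≤ 1 := by
  have h : ‖U‖ * ‖U‖ ≤ 1 := by
    rw [← l2_opNorm_conjTranspose_mul_self, hU, ← diagonal_one, l2_opNorm_diagonal]
    exact (pi_norm_const_le (1 : ℂ)).trans norm_one.le
  nlinarith [norm_nonneg U]

theorem norm_trace_mul_le [DecidableEq m] (W : Matrix n m ℂ) (A : Matrix m n ℂ) :
    ‖(W * A).trace‖ ≤ ‖W‖ * traceNorm A := by
  obtain ⟨r, U, s, V, h⟩ := exists_isSVD A
  have hentry : ∀ j, ‖(Vᴴ * W * U) j j‖ ≤ ‖W‖ := fun j =>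
    calc ‖(Vᴴ * W * U) j j‖ ≤ ‖Vᴴ * W * U‖ := norm_apply_le_l2_opNorm _ j j
      _ ≤ ‖Vᴴ‖ * ‖W‖ * ‖U‖ :=
        (l2_opNorm_mul _ _).trans (by gcongr; exact l2_opNorm_mul _ _)
      _ ≤ 1 * ‖W‖ * 1 := by
        rw [l2_opNorm_conjTranspose]
        gcongr
        · exact l2_opNorm_le_one_of_conjTranspose_mul_self_eq_one h.right_isometry
        · exact l2_opNorm_le_one_of_conjTranspose_mul_self_eq_one h.left_isometry
      _ = ‖W‖ := by ring
  have htrace : (W * A).trace = ∑ j, (Vᴴ * W * U) j j * s j := by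
    nth_rw 1 [h.eq_mul]
    rw [← Matrix.mul_assoc, trace_mul_comm, ← Matrix.mul_assoc, ← Matrix.mul_assoc]
    simp only [trace, diag_apply, mul_diagonal]
  calc ‖(W * A).trace‖ ≤ ∑ j, ‖(Vᴴ * W * U) j j * s j‖ := htrace ▸ norm_sum_le _ _
    _ ≤ ∑ j, ‖W‖ * s j := Finset.sum_le_sum fun j _ => by
        rw [norm_mul, Complex.norm_of_nonneg (h.nonneg j)]
        exact mul_le_mul_of_nonneg_right (hentry j) (h.nonneg j)
    _ = ‖W‖ * traceNorm A := by rw [← Finset.mul_sum, h.traceNorm_eq_sum]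

theorem exists_norm_le_one_trace_mul_eq_traceNorm [DecidableEq m] (A : Matrix m n ℂ) :
    ∃ W : Matrix n m ℂ, ‖W‖ ≤ 1 ∧ (W * A).trace = traceNorm A := by
  obtain ⟨r, U, s, V, h⟩ := exists_isSVD A
  refine ⟨V * Uᴴ, ?_, ?_⟩
  · calc ‖V * Uᴴ‖ ≤ ‖V‖ * ‖Uᴴ‖ := l2_opNorm_mul _ _
      _ ≤ 1 := by
        rw [l2_opNorm_conjTranspose]
        exact mul_le_one₀ (l2_opNorm_le_one_of_conjTranspose_mul_self_eq_one h.right_isometry)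
          (norm_nonneg _) (l2_opNorm_le_one_of_conjTranspose_mul_self_eq_one h.left_isometry)
  · have hWA : V * Uᴴ * A = V * (Uᴴ * U) * diagonal (fun j => (s j : ℂ)) * Vᴴ := by
      nth_rw 1 [h.eq_mul]
      simp only [Matrix.mul_assoc]
    rw [hWA, h.left_isometry, Matrix.mul_one, trace_mul_comm, ← Matrix.mul_assoc,
      h.right_isometry, Matrix.one_mul, trace_diagonal, h.traceNorm_eq_sum, Complex.ofReal_sum]

theorem traceNorm_sum_le (t : Finset ι) (A : ι → Matrix m n ℂ) :
    traceNorm (∑ i ∈ t, A i) ≤ ∑ i ∈ t, traceNorm (A i) := by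
  classical
  obtain ⟨W, hW, htr⟩ := exists_norm_le_one_trace_mul_eq_traceNorm (∑ i ∈ t, A i)
  calc traceNorm (∑ i ∈ t, A i) ≤ ‖(W * ∑ i ∈ t, A i).trace‖ := by
        rw [htr, Complex.norm_real]
        exact le_abs_self _
    _ ≤ ∑ i ∈ t, ‖(W * A i).trace‖ := by
        rw [Matrix.mul_sum, trace_sum]
        exact norm_sum_le _ _
    _ ≤ ∑ i ∈ t, traceNorm (A i) := Finset.sum_le_sum fun i _ =>
        (norm_trace_mul_le W (A i)).trans (mul_le_of_le_one_left (traceNorm_nonneg _) hW)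

theorem traceNorm_vecMulVec_le (x : m → ℂ) (y : n → ℂ) :
    traceNorm (vecMulVec x y) ≤ ‖WithLp.toLp 2 x‖ * ‖WithLp.toLp 2 y‖ := by
  classical
  obtain ⟨W, hW, htr⟩ := exists_norm_le_one_trace_mul_eq_traceNorm (vecMulVec x y)
  have hinner : inner ℂ (WithLp.toLp 2 (star y)) (WithLp.toLp 2 (W *ᵥ x)) =
      (traceNorm (vecMulVec x y) : ℂ) := by
    rw [← htr, mul_vecMulVec, trace_vecMulVec, EuclideanSpace.inner_toLp_toLp, star_star]
  calc traceNorm (vecMulVec x y)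
      ≤ ‖inner ℂ (WithLp.toLp 2 (star y)) (WithLp.toLp 2 (W *ᵥ x))‖ := by
        rw [hinner, Complex.norm_real]
        exact le_abs_self _
    _ ≤ ‖WithLp.toLp 2 y‖ * ‖WithLp.toLp 2 (W *ᵥ x)‖ :=
        norm_toLp_star y ▸ norm_inner_le_norm _ _
    _ ≤ ‖WithLp.toLp 2 y‖ * ‖WithLp.toLp 2 x‖ := by
        gcongr
        exact (W.l2_opNorm_mulVec (WithLp.toLp 2 x)).trans
          (mul_le_of_le_one_left (norm_nonneg _) hW)
    _ = ‖WithLp.toLp 2 x‖ * ‖WithLp.toLp 2 y‖ := mul_comm _ _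

end Duality

section PartialTrace

variable {dA dB : ℕ}

lemma reducedA_add (Z Z' : BipartiteMatrix dA dB) :
    reducedA (Z + Z') = reducedA Z + reducedA Z' := by
  ext
  simp only [reducedA, of_apply, Matrix.add_apply, Finset.sum_add_distrib]

lemma reducedB_add (Z Z' : BipartiteMatrix dA dB) :
    reducedB (Z + Z') = reducedB Z + reducedB Z' := by
  ext
  simp only [reducedB, of_apply, Matrix.add_apply, Finset.sum_add_distrib]

lemma realign_add (Z Z' : BipartiteMatrix dA dB) : realign (Z + Z') = realign Z + realign Z' :=
  rfl

lemma reducedA_smul (c : ℂ) (Z : BipartiteMatrix dA dB) : reducedA (c • Z) = c • reducedA Z := by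
  ext
  simp only [reducedA, of_apply, Matrix.smul_apply, Finset.smul_sum]

lemma reducedB_smul (c : ℂ) (Z : BipartiteMatrix dA dB) : reducedB (c • Z) = c • reducedB Z := by
  ext
  simp only [reducedB, of_apply, Matrix.smul_apply, Finset.smul_sum]

lemma realign_smul (c : ℂ) (Z : BipartiteMatrix dA dB) : realign (c • Z) = c • realign Z :=
  rfl

lemma reducedA_kronecker (X : Matrix (Fin dA) (Fin dA) ℂ) (Y : Matrix (Fin dB) (Fin dB) ℂ) :
    reducedA (X ⊗ₖ Y) = Y.trace • X := by
  ext i j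
  simp only [reducedA, of_apply, kroneckerMap_apply, ← Finset.mul_sum, mul_comm (X i j),
    Matrix.smul_apply, smul_eq_mul, trace, diag_apply]

lemma reducedB_kronecker (X : Matrix (Fin dA) (Fin dA) ℂ) (Y : Matrix (Fin dB) (Fin dB) ℂ) :
    reducedB (X ⊗ₖ Y) = X.trace • Y := by
  ext k l
  simp only [reducedB, of_apply, kroneckerMap_apply, ← Finset.sum_mul, Matrix.smul_apply,
    smul_eq_mul, trace, diag_apply]

lemma realign_kronecker (X : Matrix (Fin dA) (Fin dA) ℂ) (Y : Matrix (Fin dB) (Fin dB) ℂ) :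
    realign (X ⊗ₖ Y) = vecMulVec X.vec Y.vec :=
  rfl

end PartialTrace

lemma norm_vec_vecMulVec {m n : Type*} [Fintype m] [Fintype n] (x : m → ℂ) (y : n → ℂ) :
    ‖WithLp.toLp 2 (vecMulVec x y).vec‖ = ‖WithLp.toLp 2 x‖ * ‖WithLp.toLp 2 y‖ := by
  rw [← sq_eq_sq₀ (norm_nonneg _) (by positivity), mul_pow]
  simp only [EuclideanSpace.norm_sq_eq, Fintype.sum_prod_type_right, vec_eq_uncurry,
    Function.uncurry, vecMulVec_apply, norm_mul, mul_pow, Finset.sum_mul_sum]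

section Augmented

variable {dA dB : ℕ} {ι κ κ' : Type*}

/-- The vector with blocks `tr(X) a` and `Vec(X)`, the factor of `augmentedRealign` on a product
operator. -/
def augmentedVec [Fintype ι] (a : κ → ℂ) (X : Matrix ι ι ℂ) : κ ⊕ ι × ι → ℂ :=
  Sum.elim (X.trace • a) X.vec

/-- The homogenization of `Q`: the corner block is multiplied by `tr(Z)`, which makes the block
matrix linear in `Z` and leaves it unchanged on operators of trace one. -/
def augmentedRealign (a : κ → ℂ) (b : κ' → ℂ) : BipartiteMatrix dA dB →ₗ[ℂ]
    Matrix (κ ⊕ Fin dA × Fin dA) (κ' ⊕ Fin dB × Fin dB) ℂ where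
  toFun Z := fromBlocks (Z.trace • vecMulVec a b) (vecMulVec a (reducedB Z).vec)
    (vecMulVec (reducedA Z).vec b) (realign Z)
  map_add' Z Z' := by
    rw [trace_add, add_smul, reducedA_add, reducedB_add, realign_add, vec_add, vec_add,
      vecMulVec_add, add_vecMulVec, fromBlocks_add]
  map_smul' c Z := by
    rw [trace_smul, smul_assoc, reducedA_smul, reducedB_smul, realign_smul, vec_smul, vec_smul,
      vecMulVec_smul, smul_vecMulVec, RingHom.id_apply, fromBlocks_smul]

lemma augmentedRealign_of_trace_eq_one {n m : ℕ} (μ : EuclideanSpace ℝ (Fin n))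
    (ν : EuclideanSpace ℝ (Fin m)) {ρ : BipartiteMatrix dA dB} (hρ : ρ.trace = 1) :
    augmentedRealign (complexify μ) (complexify ν) ρ = Q μ ν ρ := by
  simp only [augmentedRealign, Q, LinearMap.coe_mk, AddHom.coe_mk, hρ, one_smul]

lemma augmentedRealign_kronecker (a : κ → ℂ) (b : κ' → ℂ) (X : Matrix (Fin dA) (Fin dA) ℂ)
    (Y : Matrix (Fin dB) (Fin dB) ℂ) :
    augmentedRealign a b (X ⊗ₖ Y) = vecMulVec (augmentedVec a X) (augmentedVec b Y) := by
  simp only [augmentedRealign, LinearMap.coe_mk, AddHom.coe_mk, trace_kronecker,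
    reducedA_kronecker, reducedB_kronecker, realign_kronecker]
  ext (_ | _) (_ | _) <;>
    simp only [vec_smul, vecMulVec_apply, fromBlocks_apply₁₁, fromBlocks_apply₁₂,
      fromBlocks_apply₂₁, fromBlocks_apply₂₂, Matrix.smul_apply, Pi.smul_apply, smul_eq_mul,
      augmentedVec, Sum.elim_inl, Sum.elim_inr] <;>
    ring

lemma norm_augmentedVec_sq [Fintype ι] [Fintype κ] (a : κ → ℂ) (X : Matrix ι ι ℂ) :
    ‖WithLp.toLp 2 (augmentedVec a X)‖ ^ 2 =
      ‖X.trace‖ ^ 2 * ‖WithLp.toLp 2 a‖ ^ 2 + ‖WithLp.toLp 2 X.vec‖ ^ 2 := by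
  simp only [EuclideanSpace.norm_sq_eq, Fintype.sum_sum_type, augmentedVec, Sum.elim_inl,
    Sum.elim_inr, Pi.smul_apply, norm_smul, mul_pow, Finset.mul_sum]

end Augmented

lemma sum_mul_mul_ite_eq {ι R : Type*} [Fintype ι] [DecidableEq ι] [CommRing R] (s : ι → R)
    (c : R) :
    ∑ q : ι × ι, s q.1 * s q.2 * (if q.1 = q.2 then c else 1) =
      (∑ j, s j) ^ 2 + (c - 1) * ∑ j, s j ^ 2 := by
  have hsplit : ∀ j l, s j * s l * (if j = l then c else 1) =
      s j * s l + if j = l then (c - 1) * s j ^ 2 else 0 := fun j l => by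
    split_ifs with h
    · rw [h]
      ring
    · ring
  simp only [Fintype.sum_prod_type, hsplit, Finset.sum_add_distrib, Finset.sum_ite_eq,
    Finset.mem_univ, if_true, pow_two (∑ j, s j), Finset.sum_mul_sum, ← Finset.mul_sum]

section Dyad

variable {ι σ κ κ' : Type*} [Fintype ι] [DecidableEq σ]

/-- The operator `|u_j⟩⟨u_l|` built from the columns `u` of a matrix. -/
def colDyad (U : Matrix ι σ ℂ) (j l : σ) : Matrix ι ι ℂ :=
  vecMulVec (U.col j) (star (U.col l))

lemma col_dotProduct_star_col {U : Matrix ι σ ℂ} (hU : Uᴴ * U = 1) (j l : σ) :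
    U.col j ⬝ᵥ star (U.col l) = if j = l then 1 else 0 := by
  simp only [eq_comm (a := j), ← one_apply, ← hU, dotProduct_comm (U.col j)]
  rfl

lemma norm_col_eq_one {U : Matrix ι σ ℂ} (hU : Uᴴ * U = 1) (j : σ) :
    ‖WithLp.toLp 2 (U.col j)‖ = 1 := by
  have h := col_dotProduct_star_col hU j j
  rw [if_pos rfl, ← EuclideanSpace.inner_toLp_toLp, inner_self_eq_norm_sq_to_K] at h
  have hsq : ‖WithLp.toLp 2 (U.col j)‖ ^ 2 = 1 :=
    Complex.ofReal_injective (by simpa using h)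
  exact (pow_eq_one_iff_of_nonneg (norm_nonneg _) two_ne_zero).1 hsq

lemma conjTranspose_mul_self_map_star {V : Matrix ι σ ℂ} (hV : Vᴴ * V = 1) :
    (V.map star)ᴴ * V.map star = 1 := by
  rw [← transpose_conjTranspose, conjTranspose_conjTranspose,
    conjTranspose_transpose_eq_transpose_conjTranspose, ← transpose_mul, hV, transpose_one]

lemma norm_augmentedVec_colDyad_sq [Fintype κ] {U : Matrix ι σ ℂ} (hU : Uᴴ * U = 1) (a : κ → ℂ)
    (j l : σ) :
    ‖WithLp.toLp 2 (augmentedVec a (colDyad U j l))‖ ^ 2 =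
      if j = l then ‖WithLp.toLp 2 a‖ ^ 2 + 1 else 1 := by
  rw [norm_augmentedVec_sq, colDyad, norm_vec_vecMulVec, norm_toLp_star, norm_col_eq_one hU,
    norm_col_eq_one hU, trace_vecMulVec, col_dotProduct_star_col hU]
  split_ifs <;> simp

lemma traceNorm_vecMulVec_augmentedVec_colDyad_le {ι' : Type*} [Fintype ι'] [DecidableEq ι']
    [Fintype κ] [Fintype κ'] [DecidableEq κ'] {U : Matrix ι σ ℂ} {W : Matrix ι' σ ℂ}
    (hU : Uᴴ * U = 1) (hW : Wᴴ * W = 1) (a : κ → ℂ) (b : κ' → ℂ) (j l : σ) :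
    traceNorm (vecMulVec (augmentedVec a (colDyad U j l)) (augmentedVec b (colDyad W j l))) ≤
      if j = l then √((‖WithLp.toLp 2 a‖ ^ 2 + 1) * (‖WithLp.toLp 2 b‖ ^ 2 + 1)) else 1 := by
  refine (traceNorm_vecMulVec_le _ _).trans_eq ?_
  rw [← sq_eq_sq₀ (by positivity) (by positivity), mul_pow, norm_augmentedVec_colDyad_sq hU,
    norm_augmentedVec_colDyad_sq hW]
  split_ifs
  · rw [Real.sq_sqrt (by positivity)]
  · norm_num

end Dyad

section Schmidt

variable {dA dB : ℕ} {ι κ κ' : Type*} [Fintype ι] [DecidableEq ι] {φ : BipartiteVector dA dB}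
  {U : Matrix (Fin dA) ι ℂ} {s : ι → ℝ} {V : Matrix (Fin dB) ι ℂ}

/-- The matrix of coefficients of a bipartite vector in the product basis. A singular value
decomposition of it is a Schmidt decomposition of the vector, with Schmidt vectors the columns of
`U` and the conjugates of the columns of `V`. -/
def coeffMatrix (φ : BipartiteVector dA dB) : Matrix (Fin dA) (Fin dB) ℂ :=
  of fun i k => φ (i, k)

lemma partialTransposeB_projector (φ : BipartiteVector dA dB) :
    partialTransposeB (projector φ) =
      (coeffMatrix φ ⊗ₖ (coeffMatrix φ)ᴴ).submatrix (Equiv.refl _) (Equiv.prodComm _ _) :=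
  rfl

theorem traceNorm_partialTransposeB_projector (φ : BipartiteVector dA dB) :
    traceNorm (partialTransposeB (projector φ)) = traceNorm (coeffMatrix φ) ^ 2 := by
  rw [partialTransposeB_projector, traceNorm_submatrix_equiv, traceNorm_kronecker,
    traceNorm_conjTranspose, pow_two]

lemma trace_projector (φ : BipartiteVector dA dB) : (projector φ).trace = (‖φ‖ : ℂ) ^ 2 := by
  rw [projector, trace_vecMulVec]
  exact (EuclideanSpace.inner_eq_star_dotProduct φ φ).symm.trans (inner_self_eq_norm_sq_to_K φ)

lemma trace_conjTranspose_mul_coeffMatrix (φ : BipartiteVector dA dB) :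
    ((coeffMatrix φ)ᴴ * coeffMatrix φ).trace = (‖φ‖ : ℂ) ^ 2 := by
  rw [← trace_projector, trace_mul_comm]
  simp only [trace, diag_apply, Matrix.mul_apply, Fintype.sum_prod_type]
  rfl

namespace IsSVD

lemma sum_sq_eq_norm_sq (h : IsSVD (coeffMatrix φ) U s V) : ∑ j, s j ^ 2 = ‖φ‖ ^ 2 := by
  have htr := h.trace_conjTranspose_mul_self
  rw [trace_conjTranspose_mul_coeffMatrix] at htr
  exact_mod_cast htr.symm

lemma projector_eq_sum (h : IsSVD (coeffMatrix φ) U s V) :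
    projector φ = ∑ q : ι × ι, ((s q.1 * s q.2 : ℝ) : ℂ) •
      (colDyad U q.1 q.2 ⊗ₖ colDyad (V.map star) q.1 q.2) := by
  have hφ : ∀ i k, φ (i, k) = ∑ j, U i j * s j * star (V k j) := h.apply_eq_sum
  ext ⟨i, k⟩ ⟨i', k'⟩
  simp only [projector, vecMulVec_apply, hφ, star_sum, Finset.sum_mul_sum, Fintype.sum_prod_type,
    Matrix.sum_apply, Matrix.smul_apply, kroneckerMap_apply, colDyad]
  refine Finset.sum_congr rfl fun j _ => Finset.sum_congr rfl fun l _ => ?_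
  simp only [star_mul', Complex.star_def, Complex.conj_ofReal, Complex.conj_conj,
    Complex.ofReal_mul, col_apply, Pi.star_apply, map_apply, smul_eq_mul]
  ring

end IsSVD

theorem traceNorm_augmentedRealign_projector_le [Fintype κ] [Fintype κ'] [DecidableEq κ']
    (a : κ → ℂ) (b : κ' → ℂ) (hφ : ‖φ‖ = 1) :
    traceNorm (augmentedRealign a b (projector φ)) ≤
      traceNorm (partialTransposeB (projector φ)) - 1 +
        √((‖WithLp.toLp 2 a‖ ^ 2 + 1) * (‖WithLp.toLp 2 b‖ ^ 2 + 1)) := by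
  obtain ⟨r, U, s, V, h⟩ := exists_isSVD (coeffMatrix φ)
  have hV := conjTranspose_mul_self_map_star h.right_isometry
  set c := √((‖WithLp.toLp 2 a‖ ^ 2 + 1) * (‖WithLp.toLp 2 b‖ ^ 2 + 1))
  calc traceNorm (augmentedRealign a b (projector φ))
      = traceNorm (∑ q : Fin r × Fin r, ((s q.1 * s q.2 : ℝ) : ℂ) •
          vecMulVec (augmentedVec a (colDyad U q.1 q.2))
            (augmentedVec b (colDyad (V.map star) q.1 q.2))) := by
        simp only [h.projector_eq_sum, map_sum, map_smul, augmentedRealign_kronecker]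
    _ ≤ ∑ q : Fin r × Fin r, s q.1 * s q.2 * if q.1 = q.2 then c else 1 := by
        refine (traceNorm_sum_le _ _).trans (Finset.sum_le_sum fun q _ => ?_)
        have hs := mul_nonneg (h.nonneg q.1) (h.nonneg q.2)
        rw [traceNorm_smul, Complex.norm_of_nonneg hs]
        exact mul_le_mul_of_nonneg_left
          (traceNorm_vecMulVec_augmentedVec_colDyad_le h.left_isometry hV a b q.1 q.2) hs
    _ = traceNorm (partialTransposeB (projector φ)) - 1 + c := by
        rw [sum_mul_mul_ite_eq, h.sum_sq_eq_norm_sq, hφ, traceNorm_partialTransposeB_projector,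
          h.traceNorm_eq_sum]
        ring

end Schmidt

section ConvexRoof

variable {dA dB n m : ℕ}

lemma norm_toLp_complexify (μ : EuclideanSpace ℝ (Fin n)) :
    ‖WithLp.toLp 2 (complexify μ)‖ = ‖μ‖ := by
  simp only [EuclideanSpace.norm_eq, complexify, Complex.norm_real]

lemma trace_projector_of_norm_eq_one {φ : BipartiteVector dA dB} (hφ : ‖φ‖ = 1) :
    (projector φ).trace = 1 := by
  rw [trace_projector, hφ, Complex.ofReal_one, one_pow]

theorem traceNorm_Q_projector_le (μ : EuclideanSpace ℝ (Fin n)) (ν : EuclideanSpace ℝ (Fin m))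
    {φ : BipartiteVector dA dB} (hφ : ‖φ‖ = 1) :
    traceNorm (Q μ ν (projector φ)) ≤
      traceNorm (partialTransposeB (projector φ)) - 1 + √((‖μ‖ ^ 2 + 1) * (‖ν‖ ^ 2 + 1)) := by
  have h := traceNorm_augmentedRealign_projector_le (complexify μ) (complexify ν) hφ
  rwa [augmentedRealign_of_trace_eq_one μ ν (trace_projector_of_norm_eq_one hφ),
    norm_toLp_complexify, norm_toLp_complexify] at h

namespace IsPureDecomposition

variable {ρ : BipartiteMatrix dA dB} {k : ℕ} {p : Fin k → ℝ} {φ : Fin k → BipartiteVector dA dB}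

lemma trace_eq_one (h : IsPureDecomposition p φ ρ) : ρ.trace = 1 := by
  obtain ⟨_, hsum, hφ, rfl⟩ := h
  simp only [trace_sum, trace_smul, trace_projector_of_norm_eq_one (hφ _), smul_eq_mul, mul_one]
  exact_mod_cast hsum

theorem traceNorm_Q_le (h : IsPureDecomposition p φ ρ) (μ : EuclideanSpace ℝ (Fin n))
    (ν : EuclideanSpace ℝ (Fin m)) :
    traceNorm (Q μ ν ρ) ≤ ∑ i, p i * traceNorm (Q μ ν (projector (φ i))) := by
  rw [← augmentedRealign_of_trace_eq_one μ ν h.trace_eq_one]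
  obtain ⟨hp, _, hφ, rfl⟩ := h
  simp only [map_sum, map_smul,
    augmentedRealign_of_trace_eq_one μ ν (trace_projector_of_norm_eq_one (hφ _))]
  refine (traceNorm_sum_le _ _).trans_eq (Finset.sum_congr rfl fun i _ => ?_)
  rw [traceNorm_smul, Complex.norm_of_nonneg (hp i)]

end IsPureDecomposition

theorem IsState.exists_isPureDecomposition {ρ : BipartiteMatrix dA dB} (hρ : IsState ρ) :
    ∃ (k : ℕ) (p : Fin k → ℝ) (φ : Fin k → BipartiteVector dA dB), IsPureDecomposition p φ ρ := by
  obtain ⟨hpos, htr⟩ := hρ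
  set ev := hpos.isHermitian.eigenvalues
  set v := hpos.isHermitian.eigenvectorBasis
  let e := (Fintype.equivFin (Fin dA × Fin dB)).symm
  have hsum : ∑ x, ev x = 1 := Complex.ofReal_injective <| by
    rw [Complex.ofReal_sum, Complex.ofReal_one, ← htr]
    exact hpos.isHermitian.trace_eq_sum_eigenvalues.symm
  have hspec : ρ = ∑ x, (ev x : ℂ) • projector (v x) := by
    have h := hpos.isHermitian.spectral_theorem
    rw [Unitary.conjStarAlgAut_apply] at h
    ext a b
    refine (congrFun₂ h a b).trans ?_
    rw [Matrix.sum_apply, Matrix.mul_apply]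
    refine Finset.sum_congr rfl fun j _ => ?_
    simp only [mul_diagonal, projector, vecMulVec_apply, IsHermitian.eigenvectorUnitary_apply,
      Matrix.smul_apply, star_apply, Function.comp_apply, smul_eq_mul, Complex.coe_algebraMap]
    exact (mul_right_comm _ _ _).trans (mul_comm _ _)
  exact ⟨_, fun i => ev (e i), fun i => v (e i), fun i => hpos.eigenvalues_nonneg _,
    (e.sum_comp ev).trans hsum, fun i => v.orthonormal.1 _,
    hspec.trans (e.sum_comp fun x => (ev x : ℂ) • projector (v x)).symm⟩

end ConvexRoof

end Realign

theorem theorem3 (dA dB : ℕ) (hd : 2 ≤ min dA dB) (n m : ℕ)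
    (μ : EuclideanSpace ℝ (Fin n)) (ν : EuclideanSpace ℝ (Fin m))
    (ρ : Realign.BipartiteMatrix dA dB) (hρ : Realign.IsState ρ) :
    Realign.cren ρ ≥
      (Realign.traceNorm (Realign.Q μ ν ρ) - Real.sqrt ((‖μ‖ ^ 2 + 1) * (‖ν‖ ^ 2 + 1))) /
        (((min dA dB : ℕ) : ℝ) - 1) := by
  obtain ⟨k₀, p₀, φ₀, h₀⟩ := hρ.exists_isPureDecomposition
  refine le_csInf ⟨_, k₀, p₀, φ₀, h₀, rfl⟩ ?_
  rintro _ ⟨k, p, φ, h, rfl⟩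
  set d : ℝ := ((min dA dB : ℕ) : ℝ) - 1
  have hd' : 0 ≤ d := sub_nonneg.2 (by exact_mod_cast one_le_two.trans hd)
  set c := √((‖μ‖ ^ 2 + 1) * (‖ν‖ ^ 2 + 1))
  calc (Realign.traceNorm (Realign.Q μ ν ρ) - c) / d
      ≤ (∑ i, p i * Realign.traceNorm (Realign.Q μ ν (Realign.projector (φ i))) - c) / d := by
        gcongr
        exact h.traceNorm_Q_le μ ν
    _ = ∑ i, p i * ((Realign.traceNorm (Realign.Q μ ν (Realign.projector (φ i))) - c) / d) := by
        simp only [← mul_div_assoc, mul_sub, ← Finset.sum_div, Finset.sum_sub_distrib,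
          ← Finset.sum_mul, h.2.1, one_mul]
    _ ≤ ∑ i, p i * Realign.pureNegativity (φ i) := by
        gcongr with i
        · exact h.1 i
        · exact div_le_div_of_nonneg_right
            (sub_le_iff_le_add.2 (Realign.traceNorm_Q_projector_le μ ν (h.2.2.1 i))) hd'
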